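/- Let $(B,g)$ and $(F,\ddot g)$ be non-empty smooth surfaces (two-dimensional manifolds) equipped with smooth Riemannian (or, more generally, semi-Riemannian) metrics, and let $f:B\to(0,\infty)$ be a smooth function. The warped product $B\times_f F$ is the four-dimensional manifold $M=B\times F$ with the metric $\bar g=g+f^2\ddot g$ (pullbacks to $M$ understood). Suppose that the scalar curvature of $(B,g)$ is a constant multiple of the warping function, $R_B=c f$ for some $c\in\mathbb R$ (the "$f$-curvature-Base" condition), and that $(F,\ddot g)$ is Ricci-flat, $\ddot{\mathrm{Ric}}=0$. Then an Einstein warped product of this kind, $\overline{\mathrm{Ric}}=\lambda\bar g$ with a constant $\lambda\in\mathbb R$, exists if and only if $\lambda=0$. That is: if $\overline{\mathrm{Ric}}=\lambda\bar g$, then $\lambda=0$, so that no such non-Ricci-flat $M$ exists; and for $\lambda=0$ there do exist such warped products (with $g$, $\ddot g$ Riemannian and $B$, $F$ connected). -/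

import Mathlib

open scoped Manifold ContDiff

universe u v

set_option maxSynthPendingDepth 3

noncomputable section

/-! ### Curvature of a metric given in coordinates

`G` is a field of bilinear forms on (an open part of) a finite-dimensional real vector space `E`;
`G y u v` is the inner product at the point `y` of the constant vector fields `u` and `v`. -/

section Coordinates

variable {E : Type*} [NormedAddCommGroup E] [NormedSpace ℝ E]

/-- The Christoffel symbols of the first kind,
`(u, v, w) ↦ (∂_u G(v, w) + ∂_v G(u, w) - ∂_w G(u, v)) / 2`. -/
def christoffelLower (G : E → E →L[ℝ] E →L[ℝ] ℝ) (y : E) : E →L[ℝ] E →L[ℝ] E →L[ℝ] ℝ :=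
  (1 / 2 : ℝ) • (fderiv ℝ G y + (fderiv ℝ G y).flip -
    (ContinuousLinearMap.flipₗᵢ ℝ E E ℝ).toContinuousLinearEquiv.toContinuousLinearMap ∘L
      (fderiv ℝ G y).flip)

theorem christoffelLower_apply (G : E → E →L[ℝ] E →L[ℝ] ℝ) (y u v w : E) :
    christoffelLower G y u v w =
      1 / 2 * (fderiv ℝ G y u v w + fderiv ℝ G y v u w - fderiv ℝ G y w u v) := rfl

/-- The Levi-Civita connection of `G` in coordinates: `christoffel G y u v` is the value at `y` of
`∇_u v` for the constant vector fields `u`, `v`, that is, the vector whose `G y`-product with every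
`w` is `christoffelLower G y u v w`. -/
def christoffel (G : E → E →L[ℝ] E →L[ℝ] ℝ) (y : E) : E →L[ℝ] E →L[ℝ] E :=
  ContinuousLinearMap.compL ℝ E (E →L[ℝ] ℝ) E (G y).inverse ∘L christoffelLower G y

theorem christoffel_apply (G : E → E →L[ℝ] E →L[ℝ] ℝ) (y u v : E) :
    christoffel G y u v = (G y).inverse (christoffelLower G y u v) := rfl

/-- The curvature operator `u ↦ R(u, v) w = ∇_u ∇_v w - ∇_v ∇_u w` (for constant vector fields) at
the point `y`. -/
def curvatureOp (G : E → E →L[ℝ] E →L[ℝ] ℝ) (y v w : E) : E →L[ℝ] E :=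
  ((fderiv ℝ (christoffel G) y).flip v).flip w - (fderiv ℝ (christoffel G) y v).flip w +
    (christoffel G y).flip (christoffel G y v w) - christoffel G y v ∘L (christoffel G y).flip w

theorem curvatureOp_apply (G : E → E →L[ℝ] E →L[ℝ] ℝ) (y u v w : E) :
    curvatureOp G y v w u =
      fderiv ℝ (christoffel G) y u v w - fderiv ℝ (christoffel G) y v u w +
        christoffel G y u (christoffel G y v w) - christoffel G y v (christoffel G y u w) := rfl

variable [FiniteDimensional ℝ E]

/-- The Ricci tensor at `y`: `Ric(v, w)` is the trace of `u ↦ R(u, v) w`. -/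
def ricci (G : E → E →L[ℝ] E →L[ℝ] ℝ) (y : E) : E →ₗ[ℝ] E →ₗ[ℝ] ℝ :=
  LinearMap.mk₂ ℝ (fun v w => LinearMap.trace ℝ E (curvatureOp G y v w : E →ₗ[ℝ] E))
    (fun v v' w => by
      rw [← map_add]; congr 1; ext u
      simp only [ContinuousLinearMap.coe_coe, LinearMap.add_apply, curvatureOp_apply, map_add,
        add_apply]
      abel)
    (fun c v w => by
      rw [← map_smul]; congr 1; ext u
      simp only [ContinuousLinearMap.coe_coe, LinearMap.smul_apply, curvatureOp_apply, map_smul,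
        smul_apply, smul_sub, smul_add])
    (fun v w w' => by
      rw [← map_add]; congr 1; ext u
      simp only [ContinuousLinearMap.coe_coe, LinearMap.add_apply, curvatureOp_apply, map_add]
      abel)
    (fun c v w => by
      rw [← map_smul]; congr 1; ext u
      simp only [ContinuousLinearMap.coe_coe, LinearMap.smul_apply, curvatureOp_apply, map_smul,
        smul_sub, smul_add])

/-- The scalar curvature at `y`: the `G`-trace of the Ricci tensor, i.e. the trace of the
endomorphism `v ↦ G⁻¹ (Ric(v, ·))`. -/
def scalarCurvature (G : E → E →L[ℝ] E →L[ℝ] ℝ) (y : E) : ℝ :=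
  LinearMap.trace ℝ E (((G y).inverse : (E →L[ℝ] ℝ) →ₗ[ℝ] E) ∘ₗ
    (LinearMap.toContinuousLinearMap : (E →ₗ[ℝ] ℝ) ≃ₗ[ℝ] (E →L[ℝ] ℝ)).toLinearMap ∘ₗ ricci G y)

end Coordinates

/-- The pullback `(u, v) ↦ b (D u) (D v)` of a bilinear form by a linear map. -/
def pullbackForm {V W : Type*} [AddCommGroup V] [Module ℝ V] [TopologicalSpace V]
    [AddCommGroup W] [Module ℝ W] [TopologicalSpace W]
    (b : W →L[ℝ] W →L[ℝ] ℝ) (D : V →L[ℝ] W) : V →L[ℝ] V →L[ℝ] ℝ :=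
  ContinuousLinearMap.precomp ℝ D ∘L b ∘L D

theorem pullbackForm_apply {V W : Type*} [AddCommGroup V] [Module ℝ V] [TopologicalSpace V]
    [AddCommGroup W] [Module ℝ W] [TopologicalSpace W]
    (b : W →L[ℝ] W →L[ℝ] ℝ) (D : V →L[ℝ] W) (u v : V) :
    pullbackForm b D u v = b (D u) (D v) := rfl

/-! ### Metrics on manifolds (without boundary) -/

section Manifolds

variable {E : Type*} [NormedAddCommGroup E] [NormedSpace ℝ E]
  {H : Type*} [TopologicalSpace H] (I : ModelWithCorners ℝ E H)
  (M : Type*) [TopologicalSpace M] [ChartedSpace H M]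

/-- A field of bilinear forms on the tangent spaces of `M`. -/
abbrev FormField : Type _ :=
  ∀ p : M, TangentSpace I p →L[ℝ] TangentSpace I p →L[ℝ] ℝ

variable {I M}

/-- The expression of a field of bilinear forms in the coordinates of a chart `e`. -/
def chartForm (g : FormField I M) (e : OpenPartialHomeomorph M H) (y : E) :
    E →L[ℝ] E →L[ℝ] ℝ :=
  pullbackForm (g ((e.extend I).symm y)) (mfderiv 𝓘(ℝ, E) I (e.extend I).symm y ∘L
    (NormedSpace.fromTangentSpace (𝕜 := ℝ) y).symm.toContinuousLinearMap)

/-- `g` is a semi-Riemannian metric: a smooth field of nondegenerate symmetric bilinear forms. -/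
structure IsSemiRiemannianMetric (g : FormField I M) : Prop where
  symm : ∀ p u v, g p u v = g p v u
  nondegenerate : ∀ p u, (∀ v, g p u v = 0) → u = 0
  smooth : ∀ e ∈ atlas H M, ContDiffOn ℝ ∞ (chartForm g e) (e.extend I).target

/-- `g` is a Riemannian metric: a positive definite semi-Riemannian metric. -/
structure IsRiemannianMetric (g : FormField I M) : Prop extends IsSemiRiemannianMetric g where
  pos : ∀ p u, u ≠ 0 → 0 < g p u u

variable [FiniteDimensional ℝ E]

/-- `Ric = lam • g` on `M`, expressed in every chart. -/
def IsEinstein (g : FormField I M) (lam : ℝ) : Prop :=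
  ∀ e ∈ atlas H M, ∀ y ∈ (e.extend I).target, ∀ u v : E,
    ricci (chartForm g e) y u v = lam * chartForm g e y u v

/-- The scalar curvature of `g` is the function `s`, expressed in every chart. -/
def HasScalarCurvature (g : FormField I M) (s : M → ℝ) : Prop :=
  ∀ e ∈ atlas H M, ∀ y ∈ (e.extend I).target,
    scalarCurvature (chartForm g e) y = s ((e.extend I).symm y)

/-- The `f`-curvature-Base condition: the scalar curvature of `g` is a constant multiple of `f`. -/
def IsFCurvatureBase (g : FormField I M) (f : M → ℝ) : Prop :=
  ∃ c : ℝ, HasScalarCurvature g (fun p => c * f p)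

end Manifolds

/-! ### Warped products -/

section Warped

variable {E : Type*} [NormedAddCommGroup E] [NormedSpace ℝ E]
  {H : Type*} [TopologicalSpace H] {I : ModelWithCorners ℝ E H}
  {B : Type*} [TopologicalSpace B] [ChartedSpace H B]
  {E' : Type*} [NormedAddCommGroup E'] [NormedSpace ℝ E']
  {H' : Type*} [TopologicalSpace H'] {J : ModelWithCorners ℝ E' H'}
  {F : Type*} [TopologicalSpace F] [ChartedSpace H' F]

/-- The warped product metric `π_B^* g + (f ∘ π_B)² π_F^* h` on `B × F`. -/
def warpedMetric (g : FormField I B) (f : B → ℝ) (h : FormField J F) :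
    FormField (I.prod J) (B × F) := fun p =>
  pullbackForm (g p.1) (mfderiv (I.prod J) I Prod.fst p) +
    f p.1 ^ 2 • pullbackForm (h p.2) (mfderiv (I.prod J) J Prod.snd p)

/-- `B ×_f F` is a warped product which is an Einstein manifold with constant `lam`: `g` and `h` are
metrics, the warping function `f` is smooth and positive, and the Ricci tensor of
`g + f² h` is `lam` times `g + f² h`. -/
structure IsEinsteinWarpedProduct [FiniteDimensional ℝ E] [FiniteDimensional ℝ E']
    (g : FormField I B) (f : B → ℝ) (h : FormField J F) (lam : ℝ) : Prop where
  base_metric : IsSemiRiemannianMetric g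
  fiber_metric : IsSemiRiemannianMetric h
  smooth : ContMDiff I 𝓘(ℝ, ℝ) ∞ f
  pos : ∀ b, 0 < f b
  einstein : IsEinstein (warpedMetric g f h) lam

end Warped

end

/-! Write `∇f`, `Hess f` and `Δf` for the gradient, the Hessian and the Laplacian of `f` on the
base, and `m` for the dimension of the fibre. For `v`, `w` tangent to the base and `a`, `b` tangent
to the fibre, O'Neill's formulas express the Ricci tensor of `g + f² h` as
`Ric(v, w) = Ric_g(v, w) - (m / f) Hess f(v, w)` and
`Ric(a, b) = Ric_h(a, b) - h(a, b) (f Δf + (m - 1) |∇f|²)`.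
On a surface `Ric_g = (R_g / 2) g`, so the Einstein equation and `R_g = c f` turn the first formula
into `Hess f = (f / m) (c f / 2 - lam) g`, and then the second one, for a Ricci-flat fibre, into
`m (m - 1) |∇f|² = -f² ((m - 2) lam + c f)`. Differentiating this and inserting `Hess f` leaves
`((m + 2) c f - 2 lam) df = 0`. If `lam ≠ 0`, it follows that `df = 0`, hence `c f = 2 lam` by the
first equation and `c f = (2 - m) lam` by the second, so that `m lam = 0`. -/

noncomputable section

/-! ### Metrics on open sets of a vector space -/

section CoordinateMetric

variable {E : Type*} [NormedAddCommGroup E] [NormedSpace ℝ E]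

/-- `G` is a smooth semi-Riemannian metric on the open subset `U` of a vector space: the form in
which a metric on a manifold appears in a chart. Outside `U` the values of `G` are arbitrary. -/
structure IsCoordMetric (G : E → E →L[ℝ] E →L[ℝ] ℝ) (U : Set E) : Prop where
  isOpen : IsOpen U
  contDiffOn : ContDiffOn ℝ ∞ G U
  symm : ∀ y ∈ U, ∀ u v, G y u v = G y v u
  nondegenerate : ∀ y ∈ U, ∀ u, (∀ v, G y u v = 0) → u = 0

/-- The covariant derivative `u ↦ ∇_u X` of a vector field `X` with respect to the Levi-Civita
connection of `G`. -/
def covDeriv (G : E → E →L[ℝ] E →L[ℝ] ℝ) (X : E → E) (y : E) : E →L[ℝ] E :=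
  fderiv ℝ X y + (christoffel G y).flip (X y)

variable {G G' : E → E →L[ℝ] E →L[ℝ] ℝ} {U : Set E} {y : E}

theorem covDeriv_apply (X : E → E) (u : E) :
    covDeriv G X y u = fderiv ℝ X y u + christoffel G y u (X y) := rfl

theorem covDeriv_const (v : E) : covDeriv G (fun _ => v) y = (christoffel G y).flip v := by
  rw [covDeriv, fderiv_fun_const, Pi.zero_apply, zero_add]

theorem christoffel_congr (h : G =ᶠ[nhds y] G') : christoffel G y = christoffel G' y := by
  simp only [christoffel, christoffelLower, h.fderiv_eq, h.eq_of_nhds]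

theorem ricci_apply [FiniteDimensional ℝ E] (v w : E) :
    ricci G y v w = LinearMap.trace ℝ E (curvatureOp G y v w : E →ₗ[ℝ] E) := rfl

theorem ricci_congr [FiniteDimensional ℝ E] (h : G =ᶠ[nhds y] G') : ricci G y = ricci G' y := by
  have hΓ : christoffel G =ᶠ[nhds y] christoffel G' :=
    h.eventuallyEq_nhds.mono fun _ hz => christoffel_congr hz
  have hR (v w : E) : curvatureOp G y v w = curvatureOp G' y v w := by
    simp only [curvatureOp, hΓ.fderiv_eq, hΓ.eq_of_nhds]
  ext v w
  rw [ricci_apply, ricci_apply, hR]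

theorem ricci_const [FiniteDimensional ℝ E] (b : E →L[ℝ] E →L[ℝ] ℝ) (y : E) :
    ricci (fun _ => b) y = 0 := by
  have hΓ : christoffel (fun _ => b) = fun _ => 0 := by
    ext y u v
    simp [christoffel_apply, christoffelLower]
  have hR (v w : E) : curvatureOp (fun _ => b) y v w = 0 := by
    ext u
    simp [curvatureOp_apply, hΓ]
  ext v w
  simp [ricci_apply, hR]

theorem hasFDerivAt_apply_apply {E₁ E₂ E₃ : Type*} [NormedAddCommGroup E₁] [NormedSpace ℝ E₁]
    [NormedAddCommGroup E₂] [NormedSpace ℝ E₂] [NormedAddCommGroup E₃] [NormedSpace ℝ E₃]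
    {Φ : E → E₁ →L[ℝ] E₂ →L[ℝ] E₃} (hΦ : DifferentiableAt ℝ Φ y) (v : E₁) (w : E₂) :
    HasFDerivAt (fun z => Φ z v w) (((fderiv ℝ Φ y).flip v).flip w) y :=
  ((hΦ.hasFDerivAt.clm_apply (hasFDerivAt_const v y)).clm_apply
    (hasFDerivAt_const w y)).congr_fderiv (by ext; simp)

namespace IsCoordMetric

theorem contDiffAt (hG : IsCoordMetric G U) (hy : y ∈ U) : ContDiffAt ℝ ∞ G y :=
  hG.contDiffOn.contDiffAt (hG.isOpen.mem_nhds hy)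

theorem differentiableAt (hG : IsCoordMetric G U) (hy : y ∈ U) : DifferentiableAt ℝ G y :=
  (hG.contDiffAt hy).differentiableAt (by simp)

theorem fderiv_symm (hG : IsCoordMetric G U) (hy : y ∈ U) (u v w : E) :
    fderiv ℝ G y u v w = fderiv ℝ G y u w v := by
  have hsymm : (fun z => G z v w) =ᶠ[nhds y] fun z => G z w v := by
    filter_upwards [hG.isOpen.mem_nhds hy] with z hz using hG.symm z hz v w
  have hvw := hasFDerivAt_apply_apply (hG.differentiableAt hy) v w
  have hwv := hasFDerivAt_apply_apply (hG.differentiableAt hy) w v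
  exact DFunLike.congr_fun (hvw.unique (hwv.congr_of_eventuallyEq hsymm)) u

variable [FiniteDimensional ℝ E]

theorem isInvertible (hG : IsCoordMetric G U) (hy : y ∈ U) : (G y).IsInvertible := by
  have hinj : Function.Injective (G y : E →ₗ[ℝ] E →L[ℝ] ℝ) := by
    rw [injective_iff_map_eq_zero]
    exact fun u hu => hG.nondegenerate y hy u fun v => DFunLike.congr_fun hu v
  have hdim : Module.finrank ℝ E = Module.finrank ℝ (E →L[ℝ] ℝ) := by
    rw [← (LinearMap.toContinuousLinearMap : (E →ₗ[ℝ] ℝ) ≃ₗ[ℝ] (E →L[ℝ] ℝ)).finrank_eq]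
    exact Subspace.dual_finrank_eq.symm
  exact ⟨(LinearEquiv.ofInjectiveOfFinrankEq _ hinj hdim).toContinuousLinearEquiv, rfl⟩

theorem apply_inverse (hG : IsCoordMetric G U) (hy : y ∈ U) (l : E →L[ℝ] ℝ) (w : E) :
    G y ((G y).inverse l) w = l w := by
  rw [(hG.isInvertible hy).self_apply_inverse]

theorem ext (hG : IsCoordMetric G U) (hy : y ∈ U) {u v : E} (h : ∀ w, G y u w = G y v w) :
    u = v :=
  (hG.isInvertible hy).injective (ContinuousLinearMap.ext h)

theorem apply_christoffel (hG : IsCoordMetric G U) (hy : y ∈ U) (u v w : E) :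
    G y (christoffel G y u v) w =
      1 / 2 * (fderiv ℝ G y u v w + fderiv ℝ G y v u w - fderiv ℝ G y w u v) := by
  rw [christoffel_apply, hG.apply_inverse hy, christoffelLower_apply]

theorem christoffel_comm (hG : IsCoordMetric G U) (hy : y ∈ U) (u v : E) :
    christoffel G y u v = christoffel G y v u := by
  refine hG.ext hy fun w => ?_
  rw [hG.apply_christoffel hy, hG.apply_christoffel hy, hG.fderiv_symm hy w]
  ring

theorem fderiv_eq (hG : IsCoordMetric G U) (hy : y ∈ U) (u v w : E) :
    fderiv ℝ G y u v w = G y (christoffel G y u v) w + G y v (christoffel G y u w) := by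
  rw [hG.symm y hy v, hG.apply_christoffel hy, hG.apply_christoffel hy, hG.fderiv_symm hy w,
    hG.fderiv_symm hy v, hG.fderiv_symm hy u]
  ring

theorem contDiffAt_inverse (hG : IsCoordMetric G U) (hy : y ∈ U) :
    ContDiffAt ℝ ∞ (fun z => (G z).inverse) y :=
  (hG.isInvertible hy).contDiffAt_map_inverse.comp y (hG.contDiffAt hy)

theorem differentiableAt_christoffel (hG : IsCoordMetric G U) (hy : y ∈ U) :
    DifferentiableAt ℝ (christoffel G) y := by
  have hd : ContDiffAt ℝ ∞ (fderiv ℝ G) y := (hG.contDiffAt hy).fderiv_right (by simp)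
  have hflip : ContDiffAt ℝ ∞ (fun z => (fderiv ℝ G z).flip) y :=
    (ContinuousLinearMap.flipₗᵢ ℝ E E (E →L[ℝ] ℝ)).toContinuousLinearEquiv.contDiff.contDiffAt.comp
      y hd
  have hlower : ContDiffAt ℝ ∞ (christoffelLower G) y :=
    (((hd.add hflip).sub (contDiffAt_const.clm_comp hflip)).const_smul (1 / 2 : ℝ) :)
  have hchristoffel : ContDiffAt ℝ ∞ (christoffel G) y :=
    ((ContinuousLinearMap.contDiff _).contDiffAt.comp y (hG.contDiffAt_inverse hy)).clm_comp hlower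
  exact hchristoffel.differentiableAt (by simp)

theorem hasFDerivAt_inner (hG : IsCoordMetric G U) (hy : y ∈ U) {X Y : E → E}
    (hX : DifferentiableAt ℝ X y) (hY : DifferentiableAt ℝ Y y) :
    HasFDerivAt (fun z => G z (X z) (Y z))
      ((G y).flip (Y y) ∘L covDeriv G X y + G y (X y) ∘L covDeriv G Y y) y := by
  have h := ((hG.differentiableAt hy).hasFDerivAt.clm_apply hX.hasFDerivAt).clm_apply hY.hasFDerivAt
  refine h.congr_fderiv ?_
  ext u
  simp only [ContinuousLinearMap.flip_add, add_apply, ContinuousLinearMap.comp_apply,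
    ContinuousLinearMap.flip_apply, hG.fderiv_eq hy, covDeriv_apply, map_add]
  ring

theorem curvatureOp_eq_covDeriv_sub (hG : IsCoordMetric G U) (hy : y ∈ U) (u v w : E) :
    curvatureOp G y v w u = covDeriv G (fun z => christoffel G z v w) y u -
      covDeriv G (fun z => christoffel G z u w) y v := by
  have hΓ := hG.differentiableAt_christoffel hy
  simp only [covDeriv_apply, (hasFDerivAt_apply_apply hΓ _ _).fderiv, curvatureOp_apply,
    ContinuousLinearMap.flip_apply]
  abel

theorem fderiv_fderiv_eq (hG : IsCoordMetric G U) (hy : y ∈ U) (u v w z : E) :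
    fderiv ℝ (fderiv ℝ G) y u v w z =
      G y (covDeriv G (fun x => christoffel G x v w) y u) z +
        G y (christoffel G y v w) (christoffel G y u z) +
      (G y (christoffel G y u w) (christoffel G y v z) +
        G y w (covDeriv G (fun x => christoffel G x v z) y u)) := by
  have hΓ (a b : E) : DifferentiableAt ℝ (fun x => christoffel G x a b) y :=
    (hasFDerivAt_apply_apply (hG.differentiableAt_christoffel hy) a b).differentiableAt
  have hd : DifferentiableAt ℝ (fderiv ℝ G) y :=
    ((hG.contDiffAt hy).fderiv_right (m := ∞) (by simp)).differentiableAt (by simp)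
  have hl : HasFDerivAt (fun x => fderiv ℝ G x v w z)
      ((((fderiv ℝ (fderiv ℝ G) y).flip v).flip w).flip z) y :=
    ((hasFDerivAt_apply_apply hd v w).clm_apply (hasFDerivAt_const z y)).congr_fderiv
      (by ext; simp)
  have hr := (hG.hasFDerivAt_inner hy (hΓ v w) (differentiableAt_const z)).add
    (hG.hasFDerivAt_inner hy (differentiableAt_const w) (hΓ v z))
  have heq := hl.unique (hr.congr_of_eventuallyEq (by
    filter_upwards [hG.isOpen.mem_nhds hy] with x hx using hG.fderiv_eq hx v w z))
  simpa [covDeriv_const] using DFunLike.congr_fun heq u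

theorem curvatureOp_skewAdjoint (hG : IsCoordMetric G U) (hy : y ∈ U) (u v w z : E) :
    G y (curvatureOp G y v w u) z + G y w (curvatureOp G y v z u) = 0 := by
  have hsymm : fderiv ℝ (fderiv ℝ G) y u v = fderiv ℝ (fderiv ℝ G) y v u :=
    ((hG.contDiffAt hy).isSymmSndFDerivAt (by
      rw [minSmoothness_of_isRCLikeNormedField]; exact ENat.LEInfty.out)).eq u v
  have huv := hG.fderiv_fderiv_eq hy u v w z
  have hvu := hG.fderiv_fderiv_eq hy v u w z
  rw [hsymm] at huv
  simp only [hG.curvatureOp_eq_covDeriv_sub hy, map_sub, sub_apply]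
  linarith

end IsCoordMetric

end CoordinateMetric

/-! ### Curvature of surfaces -/

section SkewAdjoint

variable {V : Type*} [AddCommGroup V] [Module ℝ V] {B : LinearMap.BilinForm ℝ V}
  {A T : Module.End ℝ V}

theorem eq_zero_of_mem_skewAdjointSubmodule (hB : B.IsSymm) (hB' : B.SeparatingLeft)
    (b : Module.Basis (Fin 2) ℝ V) (hA : A ∈ B.skewAdjointSubmodule)
    (h₀₁ : B (A (b 0)) (b 1) = 0) : A = 0 := by
  have hskew (w z : V) : B (A w) z = -B (A z) w := by
    rw [(LinearMap.mem_skewAdjointSubmodule A).1 hA w z, ← hB.eq]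
    simp
  have horth (i j : Fin 2) : B (A (b i)) (b j) = 0 := by
    fin_cases i <;> fin_cases j
    · exact self_eq_neg.1 (hskew _ _)
    · exact h₀₁
    · exact (hskew _ _).trans (neg_eq_zero.2 h₀₁)
    · exact self_eq_neg.1 (hskew _ _)
  refine b.ext fun i => hB' _ fun v => ?_
  have hzero : B (A (b i)) = 0 := b.ext (horth i)
  exact DFunLike.congr_fun hzero v

theorem exists_eq_smul_of_mem_skewAdjointSubmodule (hB : B.IsSymm) (hB' : B.SeparatingLeft)
    (b : Module.Basis (Fin 2) ℝ V) (hA : A ∈ B.skewAdjointSubmodule)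
    (hT : T ∈ B.skewAdjointSubmodule) (hT₀ : T ≠ 0) : ∃ K : ℝ, A = K • T := by
  have hne : B (T (b 0)) (b 1) ≠ 0 := fun h =>
    hT₀ (eq_zero_of_mem_skewAdjointSubmodule hB hB' b hT h)
  refine ⟨B (A (b 0)) (b 1) / B (T (b 0)) (b 1), sub_eq_zero.1 ?_⟩
  refine eq_zero_of_mem_skewAdjointSubmodule hB hB' b
    (Submodule.sub_mem _ hA (Submodule.smul_mem _ _ hT)) ?_
  simp [hne]

end SkewAdjoint

section Surface

variable {E : Type*} [NormedAddCommGroup E] [NormedSpace ℝ E] [FiniteDimensional ℝ E]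
  {G : E → E →L[ℝ] E →L[ℝ] ℝ} {U : Set E} {y : E}

theorem ricci_of_curvatureOp_eq {K : ℝ}
    (hK : ∀ u v w, curvatureOp G y v w u = K • (G y v w • u - G y u w • v)) (v w : E) :
    ricci G y v w = (Module.finrank ℝ E - 1) * K * G y v w := by
  have hR : (curvatureOp G y v w : E →ₗ[ℝ] E) =
      K • (G y v w • LinearMap.id - ((G y).flip w : E →ₗ[ℝ] ℝ).smulRight v) := by
    ext u
    simp [hK]
  rw [ricci_apply, hR]
  simp only [map_smul, map_sub, LinearMap.trace_id, LinearMap.trace_smulRight, smul_eq_mul,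
    ContinuousLinearMap.coe_coe, ContinuousLinearMap.flip_apply]
  ring

theorem IsCoordMetric.scalarCurvature_of_ricci_eq (hG : IsCoordMetric G U) (hy : y ∈ U) {K : ℝ}
    (hK : ∀ v w, ricci G y v w = K * G y v w) :
    scalarCurvature G y = K * Module.finrank ℝ E := by
  have hRic : ((G y).inverse : (E →L[ℝ] ℝ) →ₗ[ℝ] E) ∘ₗ
      (LinearMap.toContinuousLinearMap : (E →ₗ[ℝ] ℝ) ≃ₗ[ℝ] (E →L[ℝ] ℝ)).toLinearMap ∘ₗ ricci G y =
      K • LinearMap.id := by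
    ext v
    refine hG.ext hy fun w => ?_
    simp [hG.apply_inverse hy, hK]
  rw [scalarCurvature, hRic, map_smul, LinearMap.trace_id, smul_eq_mul]

namespace IsCoordMetric

theorem exists_curvatureOp_eq (hG : IsCoordMetric G U) (hy : y ∈ U)
    (hE : Module.finrank ℝ E = 2) :
    ∃ K : ℝ, ∀ u v w, curvatureOp G y v w u = K • (G y v w • u - G y u w • v) := by
  let b := Module.finBasisOfFinrankEq ℝ E hE
  let B : LinearMap.BilinForm ℝ E := (G y).toBilinForm
  let A : E →L[ℝ] E :=
    fderiv ℝ (christoffel G) y (b 0) (b 1) - fderiv ℝ (christoffel G) y (b 1) (b 0) +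
      christoffel G y (b 0) ∘L christoffel G y (b 1) -
        christoffel G y (b 1) ∘L christoffel G y (b 0)
  have hA : (A : E →ₗ[ℝ] E) ∈ B.skewAdjointSubmodule :=
    (LinearMap.mem_skewAdjointSubmodule _).2 fun w z =>
      (eq_neg_of_add_eq_zero_left (hG.curvatureOp_skewAdjoint hy (b 0) (b 1) w z)).trans
        (map_neg (G y w) (A z)).symm
  let T : E →L[ℝ] E := (G y (b 1)).smulRight (b 0) - (G y (b 0)).smulRight (b 1)
  have hT_apply (w : E) : T w = G y (b 1) w • b 0 - G y (b 0) w • b 1 := rfl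
  have hT : (T : E →ₗ[ℝ] E) ∈ B.skewAdjointSubmodule :=
    (LinearMap.mem_skewAdjointSubmodule _).2 fun w z => by
      change G y (T w) z = G y w (-T z)
      simp only [hT_apply, map_sub, map_neg, map_smul, neg_apply, sub_apply, smul_apply,
        smul_eq_mul, hG.symm y hy w]
      ring
  have hT₀ : (T : E →ₗ[ℝ] E) ≠ 0 := fun h => by
    refine b.ne_zero 1 (hG.nondegenerate y hy _ fun w => ?_)
    simpa [hT_apply] using congrArg (fun x => b.repr x 0) (DFunLike.congr_fun h w)
  have hB : B.IsSymm := ⟨hG.symm y hy⟩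
  have hB' : B.SeparatingLeft := hG.nondegenerate y hy
  obtain ⟨K, hK⟩ := exists_eq_smul_of_mem_skewAdjointSubmodule hB hB' b hA hT hT₀
  refine ⟨K, fun u v w => ?_⟩
  have hKw : curvatureOp G y (b 1) w (b 0) = K • (G y (b 1) w • b 0 - G y (b 0) w • b 1) :=
    DFunLike.congr_fun hK w
  have expand (x : E) : x = b.repr x 0 • b 0 + b.repr x 1 • b 1 :=
    ((Fin.sum_univ_two _).symm.trans (b.sum_repr x)).symm
  rw [expand u, expand v]
  simp only [curvatureOp_apply, map_add, map_smul, add_apply, smul_apply] at hKw ⊢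
  linear_combination (norm := module)
    (b.repr u 0 * b.repr v 1 - b.repr u 1 * b.repr v 0) • hKw

theorem ricci_eq_scalarCurvature_div_two_mul (hG : IsCoordMetric G U) (hy : y ∈ U)
    (hE : Module.finrank ℝ E = 2) (v w : E) :
    ricci G y v w = scalarCurvature G y / 2 * G y v w := by
  obtain ⟨K, hK⟩ := hG.exists_curvatureOp_eq hy hE
  have hRic (v w : E) : ricci G y v w = K * G y v w := by
    rw [ricci_of_curvatureOp_eq hK, hE]
    push_cast
    ring
  rw [hG.scalarCurvature_of_ricci_eq hy hRic, hE, hRic]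
  push_cast
  ring

end IsCoordMetric

end Surface

/-! ### Warped products in coordinates -/

section Gradient

variable {E : Type*} [NormedAddCommGroup E] [NormedSpace ℝ E]

/-- The gradient of `f` with respect to the metric `g` in coordinates. -/
def metricGradient (g : E → E →L[ℝ] E →L[ℝ] ℝ) (f : E → ℝ) (x : E) : E :=
  (g x).inverse (fderiv ℝ f x)

/-- The Hessian of `f` with respect to the metric `g` in coordinates, as the endomorphism
`u ↦ ∇_u (∇f)`; the bilinear form `Hess f` is `(u, w) ↦ g (∇_u (∇f)) w`. -/
def hessianOp (g : E → E →L[ℝ] E →L[ℝ] ℝ) (f : E → ℝ) : E → E →L[ℝ] E :=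
  covDeriv g (metricGradient g f)

/-- The Laplacian of `f` with respect to the metric `g` in coordinates. -/
def metricLaplacian (g : E → E →L[ℝ] E →L[ℝ] ℝ) (f : E → ℝ) (x : E) : ℝ :=
  LinearMap.trace ℝ E (hessianOp g f x : E →ₗ[ℝ] E)

variable {g : E → E →L[ℝ] E →L[ℝ] ℝ} {f : E → ℝ} {U : Set E} {x : E}

theorem hessianOp_apply (u : E) :
    hessianOp g f x u =
      fderiv ℝ (metricGradient g f) x u + christoffel g x u (metricGradient g f x) := rfl

namespace IsCoordMetric

variable [FiniteDimensional ℝ E]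

theorem apply_metricGradient (hg : IsCoordMetric g U) (hx : x ∈ U) (w : E) :
    g x (metricGradient g f x) w = fderiv ℝ f x w :=
  hg.apply_inverse hx _ w

theorem differentiableAt_metricGradient (hg : IsCoordMetric g U) (hf : ContDiffAt ℝ ∞ f x)
    (hx : x ∈ U) : DifferentiableAt ℝ (metricGradient g f) x := by
  have h : ContDiffAt ℝ ∞ (metricGradient g f) x :=
    (hg.contDiffAt_inverse hx).clm_apply (hf.fderiv_right (by simp))
  exact h.differentiableAt (by simp)

theorem apply_hessianOp (hg : IsCoordMetric g U) (hf : ContDiffAt ℝ ∞ f x) (hx : x ∈ U)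
    (u w : E) :
    g x (hessianOp g f x u) w =
      fderiv ℝ (fderiv ℝ f) x u w - fderiv ℝ f x (christoffel g x u w) := by
  have hdf : DifferentiableAt ℝ (fderiv ℝ f) x :=
    (hf.fderiv_right (m := ∞) (by simp)).differentiableAt (by simp)
  have hl := hg.hasFDerivAt_inner hx (hg.differentiableAt_metricGradient hf hx)
    (differentiableAt_const w)
  have hr := hdf.hasFDerivAt.clm_apply (hasFDerivAt_const w x)
  have heq := hl.unique (hr.congr_of_eventuallyEq (by
    filter_upwards [hg.isOpen.mem_nhds hx] with z hz using hg.apply_metricGradient hz w))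
  have heq_u := DFunLike.congr_fun heq u
  simp only [covDeriv_const, add_apply, ContinuousLinearMap.comp_apply,
    ContinuousLinearMap.flip_apply, hg.apply_metricGradient hx, zero_add,
    ContinuousLinearMap.comp_zero] at heq_u
  exact eq_sub_of_add_eq heq_u

theorem hasFDerivAt_fderiv_metricGradient (hg : IsCoordMetric g U) (hf : ContDiffAt ℝ ∞ f x)
    (hx : x ∈ U) :
    HasFDerivAt (fun z => fderiv ℝ f z (metricGradient g f z))
      ((2 : ℝ) • fderiv ℝ f x ∘L hessianOp g f x) x := by
  have hd := hg.differentiableAt_metricGradient hf hx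
  have h := (hg.hasFDerivAt_inner hx hd hd).congr_of_eventuallyEq (by
    filter_upwards [hg.isOpen.mem_nhds hx] with z hz
      using (hg.apply_metricGradient (f := f) hz _).symm)
  refine h.congr_fderiv ?_
  ext u
  simp only [add_apply, ContinuousLinearMap.comp_apply, ContinuousLinearMap.flip_apply,
    smul_apply, smul_eq_mul, hg.symm x hx _ (metricGradient g f x), hg.apply_metricGradient hx]
  exact (two_mul _).symm

end IsCoordMetric

end Gradient

section WarpedForm

variable {E : Type*} [NormedAddCommGroup E] [NormedSpace ℝ E]
  {E' : Type*} [NormedAddCommGroup E'] [NormedSpace ℝ E']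

/-- The warped product `g + f² h` of two metrics in coordinates. -/
def warpedForm (g : E → E →L[ℝ] E →L[ℝ] ℝ) (f : E → ℝ) (h : E' → E' →L[ℝ] E' →L[ℝ] ℝ)
    (q : E × E') : E × E' →L[ℝ] E × E' →L[ℝ] ℝ :=
  pullbackForm (g q.1) (ContinuousLinearMap.fst ℝ E E') +
    f q.1 ^ 2 • pullbackForm (h q.2) (ContinuousLinearMap.snd ℝ E E')

variable {g : E → E →L[ℝ] E →L[ℝ] ℝ} {f : E → ℝ} {h : E' → E' →L[ℝ] E' →L[ℝ] ℝ}
  {U : Set E} {V : Set E'} {x : E} {y : E'}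

theorem warpedForm_apply (q v w : E × E') :
    warpedForm g f h q v w = g q.1 v.1 w.1 + f q.1 ^ 2 * h q.2 v.2 w.2 := rfl

theorem isCoordMetric_warpedForm (hg : IsCoordMetric g U) (hh : IsCoordMetric h V)
    (hf : ContDiffOn ℝ ∞ f U) (hf₀ : ∀ x ∈ U, f x ≠ 0) :
    IsCoordMetric (warpedForm g f h) (U ×ˢ V) where
  isOpen := hg.isOpen.prod hh.isOpen
  contDiffOn := by
    have hg' : ContDiffOn ℝ ∞ (fun q : E × E' => g q.1) (U ×ˢ V) :=
      hg.contDiffOn.comp contDiffOn_fst fun _ hq => hq.1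
    have hf' : ContDiffOn ℝ ∞ (fun q : E × E' => f q.1) (U ×ˢ V) :=
      hf.comp contDiffOn_fst fun _ hq => hq.1
    have hh' : ContDiffOn ℝ ∞ (fun q : E × E' => h q.2) (U ×ˢ V) :=
      hh.contDiffOn.comp contDiffOn_snd fun _ hq => hq.2
    exact (contDiffOn_const.clm_comp (hg'.clm_comp contDiffOn_const)).add
      ((hf'.pow 2).smul (contDiffOn_const.clm_comp (hh'.clm_comp contDiffOn_const)))
  symm q hq v w := by
    rw [warpedForm_apply, warpedForm_apply, hg.symm _ hq.1, hh.symm _ hq.2]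
  nondegenerate q hq v hv := by
    refine Prod.ext (hg.nondegenerate _ hq.1 _ fun w => ?_) (hh.nondegenerate _ hq.2 _ fun w => ?_)
    · simpa [warpedForm_apply] using hv (w, 0)
    · simpa [warpedForm_apply, hf₀ _ hq.1] using hv (0, w)

theorem hasFDerivAt_comp_fst {W : Type*} [NormedAddCommGroup W] [NormedSpace ℝ W] {φ : E → W}
    {φ' : E →L[ℝ] W} (hφ : HasFDerivAt φ φ' x) (y : E') :
    HasFDerivAt (fun q : E × E' => φ q.1) (φ' ∘L ContinuousLinearMap.fst ℝ E E') (x, y) :=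
  HasFDerivAt.comp (f := Prod.fst) (x, y) hφ hasFDerivAt_fst

theorem hasFDerivAt_comp_snd {W : Type*} [NormedAddCommGroup W] [NormedSpace ℝ W] {φ : E' → W}
    {φ' : E' →L[ℝ] W} (hφ : HasFDerivAt φ φ' y) (x : E) :
    HasFDerivAt (fun q : E × E' => φ q.2) (φ' ∘L ContinuousLinearMap.snd ℝ E E') (x, y) :=
  HasFDerivAt.comp (f := Prod.snd) (x, y) hφ hasFDerivAt_snd

theorem fderiv_warpedForm_apply (hg : IsCoordMetric g U) (hh : IsCoordMetric h V)
    (hf : ContDiffOn ℝ ∞ f U) (hf₀ : ∀ x ∈ U, f x ≠ 0) (hx : x ∈ U) (hy : y ∈ V)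
    (p v w : E × E') :
    fderiv ℝ (warpedForm g f h) (x, y) p v w =
      fderiv ℝ g x p.1 v.1 w.1 + 2 * f x * fderiv ℝ f x p.1 * h y v.2 w.2 +
        f x ^ 2 * fderiv ℝ h y p.2 v.2 w.2 := by
  have hl := hasFDerivAt_apply_apply
    ((isCoordMetric_warpedForm hg hh hf hf₀).differentiableAt (Set.mk_mem_prod hx hy)) v w
  have hdf : HasFDerivAt f _ x :=
    ((hf.contDiffAt (hg.isOpen.mem_nhds hx)).differentiableAt (by simp)).hasFDerivAt
  have hr := (hasFDerivAt_comp_fst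
    (hasFDerivAt_apply_apply (hg.differentiableAt hx) v.1 w.1) y).add
      (((hasFDerivAt_comp_fst hdf y).pow 2).mul
        (hasFDerivAt_comp_snd (hasFDerivAt_apply_apply (hh.differentiableAt hy) v.2 w.2) x))
  refine (DFunLike.congr_fun (hl.unique hr) p).trans ?_
  simp only [Nat.add_one_sub_one, pow_one, nsmul_eq_mul, Nat.cast_ofNat, add_apply,
    ContinuousLinearMap.comp_apply, ContinuousLinearMap.coe_fst', ContinuousLinearMap.flip_apply,
    smul_apply, ContinuousLinearMap.coe_snd', smul_eq_mul]
  ring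

theorem hasFDerivAt_inv_mul_fderiv (hf : ContDiffAt ℝ ∞ f x) (hf₀ : f x ≠ 0) (v : E) :
    HasFDerivAt (fun z => (f z)⁻¹ * fderiv ℝ f z v)
      ((f x)⁻¹ • (fderiv ℝ (fderiv ℝ f) x).flip v -
        ((f x)⁻¹ ^ 2 * fderiv ℝ f x v) • fderiv ℝ f x) x := by
  have hdf : HasFDerivAt f _ x := (hf.differentiableAt (by simp)).hasFDerivAt
  have hddf : HasFDerivAt (fderiv ℝ f) _ x :=
    ((hf.fderiv_right (m := ∞) (by simp)).differentiableAt (by simp)).hasFDerivAt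
  have h := ((hasDerivAt_inv hf₀).comp_hasFDerivAt x hdf).mul
    (hddf.clm_apply (hasFDerivAt_const v x))
  refine h.congr_fderiv ?_
  ext u
  simp only [Function.comp_apply, ContinuousLinearMap.comp_zero, zero_add, neg_smul, smul_neg,
    add_apply, smul_apply, ContinuousLinearMap.flip_apply, smul_eq_mul, neg_apply, inv_pow,
    sub_apply]
  ring

variable [FiniteDimensional ℝ E] [FiniteDimensional ℝ E']

theorem christoffel_warpedForm (hg : IsCoordMetric g U) (hh : IsCoordMetric h V)
    (hf : ContDiffOn ℝ ∞ f U) (hf₀ : ∀ x ∈ U, f x ≠ 0) (hx : x ∈ U) (hy : y ∈ V)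
    (v w : E × E') :
    christoffel (warpedForm g f h) (x, y) v w =
      (christoffel g x v.1 w.1 - (h y v.2 w.2 * f x) • metricGradient g f x,
        ((f x)⁻¹ * fderiv ℝ f x v.1) • w.2 + ((f x)⁻¹ * fderiv ℝ f x w.1) • v.2 +
          christoffel h y v.2 w.2) := by
  have hW := isCoordMetric_warpedForm hg hh hf hf₀
  have hq : (x, y) ∈ U ×ˢ V := ⟨hx, hy⟩
  have hfx := hf₀ x hx
  refine hW.ext hq fun z => ?_
  rw [hW.apply_christoffel hq]
  simp only [fderiv_warpedForm_apply hg hh hf hf₀ hx hy, warpedForm_apply, map_sub, map_add,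
    map_smul, add_apply, sub_apply, smul_apply, hg.apply_christoffel hx, hh.apply_christoffel hy,
    hg.apply_metricGradient hx, smul_eq_mul]
  field_simp
  ring

theorem fderiv_christoffel_warpedForm (hg : IsCoordMetric g U) (hh : IsCoordMetric h V)
    (hf : ContDiffOn ℝ ∞ f U) (hf₀ : ∀ x ∈ U, f x ≠ 0) (hx : x ∈ U) (hy : y ∈ V)
    (p v w : E × E') :
    fderiv ℝ (christoffel (warpedForm g f h)) (x, y) p v w =
      (fderiv ℝ (christoffel g) x p.1 v.1 w.1 -
          ((fderiv ℝ h y p.2 v.2 w.2 * f x + h y v.2 w.2 * fderiv ℝ f x p.1) •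
              metricGradient g f x +
            (h y v.2 w.2 * f x) • fderiv ℝ (metricGradient g f) x p.1),
        ((f x)⁻¹ * fderiv ℝ (fderiv ℝ f) x p.1 v.1 -
            (f x)⁻¹ ^ 2 * fderiv ℝ f x v.1 * fderiv ℝ f x p.1) • w.2 +
          ((f x)⁻¹ * fderiv ℝ (fderiv ℝ f) x p.1 w.1 -
            (f x)⁻¹ ^ 2 * fderiv ℝ f x w.1 * fderiv ℝ f x p.1) • v.2 +
          fderiv ℝ (christoffel h) y p.2 v.2 w.2) := by
  have hW := isCoordMetric_warpedForm hg hh hf hf₀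
  have hq : (x, y) ∈ U ×ˢ V := ⟨hx, hy⟩
  have hfx := hf.contDiffAt (hg.isOpen.mem_nhds hx)
  have hl := hasFDerivAt_apply_apply (hW.differentiableAt_christoffel hq) v w
  have hΓg : HasFDerivAt (fun q : E × E' => christoffel g q.1 v.1 w.1) _ (x, y) :=
    hasFDerivAt_comp_fst (hasFDerivAt_apply_apply (hg.differentiableAt_christoffel hx) _ _) y
  have hΓh : HasFDerivAt (fun q : E × E' => christoffel h q.2 v.2 w.2) _ (x, y) :=
    hasFDerivAt_comp_snd (hasFDerivAt_apply_apply (hh.differentiableAt_christoffel hy) _ _) x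
  have hh' : HasFDerivAt (fun q : E × E' => h q.2 v.2 w.2) _ (x, y) :=
    hasFDerivAt_comp_snd (hasFDerivAt_apply_apply (hh.differentiableAt hy) v.2 w.2) x
  have hf' : HasFDerivAt (fun q : E × E' => f q.1) _ (x, y) :=
    hasFDerivAt_comp_fst (hfx.differentiableAt (by simp)).hasFDerivAt y
  have hgrad : HasFDerivAt (fun q : E × E' => metricGradient g f q.1) _ (x, y) :=
    hasFDerivAt_comp_fst (hg.differentiableAt_metricGradient hfx hx).hasFDerivAt y
  have hlog (u : E) : HasFDerivAt (fun q : E × E' => (f q.1)⁻¹ * fderiv ℝ f q.1 u) _ (x, y) :=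
    hasFDerivAt_comp_fst (hasFDerivAt_inv_mul_fderiv hfx (hf₀ x hx) u) y
  have hr := (hΓg.sub ((hh'.mul hf').smul hgrad)).prodMk
    ((((hlog v.1).smul_const w.2).add ((hlog w.1).smul_const v.2)).add hΓh)
  have heq := hl.unique (hr.congr_of_eventuallyEq (by
    filter_upwards [hW.isOpen.mem_nhds hq] with q hq
      using christoffel_warpedForm hg hh hf hf₀ hq.1 hq.2 v w))
  refine (DFunLike.congr_fun heq p).trans (Prod.ext ?_ ?_)
  · simp only [Pi.mul_apply, inv_pow, ContinuousLinearMap.sub_comp, ContinuousLinearMap.smul_comp,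
      ContinuousLinearMap.prod_apply, sub_apply, ContinuousLinearMap.comp_apply,
      ContinuousLinearMap.coe_fst', ContinuousLinearMap.flip_apply, add_apply, smul_apply,
      ContinuousLinearMap.smulRight_apply, smul_eq_mul, ContinuousLinearMap.coe_snd', sub_right_inj]
    module
  · simp

theorem curvatureOp_warpedForm_base (hg : IsCoordMetric g U) (hh : IsCoordMetric h V)
    (hf : ContDiffOn ℝ ∞ f U) (hf₀ : ∀ x ∈ U, f x ≠ 0) (hx : x ∈ U) (hy : y ∈ V) (v w : E) :
    curvatureOp (warpedForm g f h) (x, y) (v, 0) (w, 0) =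
      (curvatureOp g x v w).prodMap
        (-((f x)⁻¹ * g x (hessianOp g f x v) w) • ContinuousLinearMap.id ℝ E') := by
  have hhess := hg.apply_hessianOp (hf.contDiffAt (hg.isOpen.mem_nhds hx)) hx v w
  refine ContinuousLinearMap.ext fun u => Prod.ext ?_ ?_
  · simp [curvatureOp_apply, fderiv_christoffel_warpedForm hg hh hf hf₀ hx hy,
      christoffel_warpedForm hg hh hf hf₀ hx hy]
  · simp only [curvatureOp_apply, fderiv_christoffel_warpedForm hg hh hf hf₀ hx hy,
      christoffel_warpedForm hg hh hf hf₀ hx hy, hhess, map_zero, zero_apply, zero_mul, add_zero,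
      zero_smul, sub_zero, inv_pow, smul_zero, zero_add, Prod.mk_sub_mk, zero_sub, Prod.mk_add_mk,
      map_smul, smul_eq_mul, mul_zero, neg_smul, ContinuousLinearMap.coe_prodMap', FunLike.coe_neg,
      FunLike.coe_smul, ContinuousLinearMap.coe_id', Prod.map_snd, Pi.neg_apply, Pi.smul_apply,
      id_eq]
    module

theorem curvatureOp_warpedForm_fiber (hg : IsCoordMetric g U) (hh : IsCoordMetric h V)
    (hf : ContDiffOn ℝ ∞ f U) (hf₀ : ∀ x ∈ U, f x ≠ 0) (hx : x ∈ U) (hy : y ∈ V) (a b : E') :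
    curvatureOp (warpedForm g f h) (x, y) (0, a) (0, b) =
      (-(h y a b * f x) • hessianOp g f x).prodMap
        (curvatureOp h y a b - fderiv ℝ f x (metricGradient g f x) •
          (h y a b • ContinuousLinearMap.id ℝ E' - ((h y).flip b).smulRight a)) := by
  have hfx := hf₀ x hx
  have hcancel (s t : ℝ) : (f x)⁻¹ * s * t * f x = s * t := by field_simp
  have hcancel' (s t : ℝ) : (f x)⁻¹ * (s * f x * t) = s * t := by field_simp
  refine ContinuousLinearMap.ext fun u => Prod.ext ?_ ?_
  · simp only [curvatureOp_apply, fderiv_christoffel_warpedForm hg hh hf hf₀ hx hy, hh.fderiv_eq hy,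
      hh.christoffel_comm hy a u.2, christoffel_warpedForm hg hh hf hf₀ hx hy, hcancel,
      hessianOp_apply, map_zero, zero_apply, add_mul, zero_sub, neg_add_rev, mul_zero, inv_pow,
      zero_mul, sub_self, zero_smul, add_zero, zero_add, smul_zero, Prod.mk_sub_mk, sub_neg_eq_add,
      map_neg, map_smul, smul_eq_mul, mul_neg, neg_smul, Prod.mk_add_mk, map_add, smul_add,
      ContinuousLinearMap.coe_prodMap', FunLike.coe_neg, FunLike.coe_smul, FunLike.coe_sub,
      ContinuousLinearMap.coe_id', Prod.map_fst, Pi.neg_apply, Pi.smul_apply]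
    module
  · simp only [curvatureOp_apply, fderiv_christoffel_warpedForm hg hh hf hf₀ hx hy,
      christoffel_warpedForm hg hh hf hf₀ hx hy, hcancel', map_zero, zero_apply, zero_sub,
      neg_add_rev, mul_zero, inv_pow, zero_mul, sub_self, zero_smul, add_zero, zero_add, smul_zero,
      Prod.mk_sub_mk, sub_neg_eq_add, map_neg, map_smul, smul_eq_mul, mul_neg, neg_smul,
      Prod.mk_add_mk, map_add, smul_add, ContinuousLinearMap.coe_prodMap', FunLike.coe_neg,
      FunLike.coe_smul, FunLike.coe_sub, ContinuousLinearMap.coe_id', Prod.map_snd, Pi.sub_apply,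
      Pi.smul_apply, id_eq, ContinuousLinearMap.smulRight_apply, ContinuousLinearMap.flip_apply]
    module

theorem ricci_warpedForm_base (hg : IsCoordMetric g U) (hh : IsCoordMetric h V)
    (hf : ContDiffOn ℝ ∞ f U) (hf₀ : ∀ x ∈ U, f x ≠ 0) (hx : x ∈ U) (hy : y ∈ V) (v w : E) :
    ricci (warpedForm g f h) (x, y) (v, 0) (w, 0) =
      ricci g x v w - Module.finrank ℝ E' * ((f x)⁻¹ * g x (hessianOp g f x v) w) := by
  rw [ricci_apply, curvatureOp_warpedForm_base hg hh hf hf₀ hx hy, ContinuousLinearMap.coe_prodMap,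
    LinearMap.trace_prodMap', ← ricci_apply]
  simp only [neg_smul, ContinuousLinearMap.toLinearMap_neg, ContinuousLinearMap.toLinearMap_smul,
    ContinuousLinearMap.coe_id, map_neg, map_smul, LinearMap.trace_id, smul_eq_mul]
  ring

theorem ricci_warpedForm_fiber (hg : IsCoordMetric g U) (hh : IsCoordMetric h V)
    (hf : ContDiffOn ℝ ∞ f U) (hf₀ : ∀ x ∈ U, f x ≠ 0) (hx : x ∈ U) (hy : y ∈ V) (a b : E') :
    ricci (warpedForm g f h) (x, y) (0, a) (0, b) =
      ricci h y a b - h y a b * (f x * metricLaplacian g f x +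
        (Module.finrank ℝ E' - 1) * fderiv ℝ f x (metricGradient g f x)) := by
  rw [ricci_apply, curvatureOp_warpedForm_fiber hg hh hf hf₀ hx hy, ContinuousLinearMap.coe_prodMap,
    LinearMap.trace_prodMap', ricci_apply, metricLaplacian]
  simp only [neg_smul, ContinuousLinearMap.toLinearMap_neg, ContinuousLinearMap.toLinearMap_smul,
    map_neg, map_smul, smul_eq_mul, ContinuousLinearMap.toLinearMap_sub, ContinuousLinearMap.coe_id,
    ContinuousLinearMap.coe_smulRight, map_sub, LinearMap.trace_id, LinearMap.trace_smulRight,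
    ContinuousLinearMap.coe_coe, ContinuousLinearMap.flip_apply]
  ring

end WarpedForm

/-! ### The Einstein constant in coordinates -/

section EinsteinConstant

variable {E : Type*} [NormedAddCommGroup E] [NormedSpace ℝ E]
  {g : E → E →L[ℝ] E →L[ℝ] ℝ} {f : E → ℝ} {U : Set E} {x : E} {c lam m : ℝ}

theorem fderiv_eq_zero_of_mul_sub_smul_eq_zero {a b : ℝ} (hU : IsOpen U) (hf : ContDiffOn ℝ 1 f U)
    (hb : b ≠ 0) (h : ∀ z ∈ U, (a * f z - b) • fderiv ℝ f z = 0) (hx : x ∈ U) :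
    fderiv ℝ f x = 0 := by
  by_contra hne
  have hfx : ContDiffAt ℝ 1 f x := hf.contDiffAt (hU.mem_nhds hx)
  have hcont : ContinuousAt (fderiv ℝ f) x := (hfx.fderiv_right (m := 0) (by simp)).continuousAt
  have hloc : (fun z => a * f z) =ᶠ[nhds x] fun _ => b := by
    filter_upwards [hU.mem_nhds hx, hcont.eventually_ne hne] with z hz hz₀
    exact sub_eq_zero.1 ((smul_eq_zero.1 (h z hz)).resolve_right hz₀)
  have hderiv : a • fderiv ℝ f x = 0 := by
    rw [← fderiv_const_mul (hfx.differentiableAt (by simp)), hloc.fderiv_eq, fderiv_fun_const]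
    rfl
  have ha : a = 0 := (smul_eq_zero.1 hderiv).resolve_right hne
  exact hb (by simpa [ha] using hloc.eq_of_nhds.symm)

variable [FiniteDimensional ℝ E]

theorem metricLaplacian_of_hessianOp_eq {r : ℝ}
    (h : hessianOp g f x = r • ContinuousLinearMap.id ℝ E) :
    metricLaplacian g f x = r * Module.finrank ℝ E := by
  simp [metricLaplacian, h]

theorem mul_fderiv_metricGradient_eq (hm : m ≠ 0) (hE : Module.finrank ℝ E = 2)
    (hhess : hessianOp g f x = (f x / m * (c * f x / 2 - lam)) • ContinuousLinearMap.id ℝ E)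
    (hlap : f x * metricLaplacian g f x + (m - 1) * fderiv ℝ f x (metricGradient g f x) =
      -lam * f x ^ 2) :
    m * (m - 1) * fderiv ℝ f x (metricGradient g f x) =
      -f x ^ 2 * ((m - 2) * lam + c * f x) := by
  rw [metricLaplacian_of_hessianOp_eq hhess, hE] at hlap
  field_simp at hlap
  push_cast at hlap
  linear_combination hlap / 2

namespace IsCoordMetric

theorem mul_sub_smul_fderiv_eq_zero (hg : IsCoordMetric g U) (hf : ContDiffOn ℝ ∞ f U)
    (hf₀ : ∀ x ∈ U, f x ≠ 0) (hm : m ≠ 0) (hE : Module.finrank ℝ E = 2)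
    (hhess : ∀ x ∈ U,
      hessianOp g f x = (f x / m * (c * f x / 2 - lam)) • ContinuousLinearMap.id ℝ E)
    (hlap : ∀ x ∈ U, f x * metricLaplacian g f x +
      (m - 1) * fderiv ℝ f x (metricGradient g f x) = -lam * f x ^ 2) (hx : x ∈ U) :
    ((m + 2) * c * f x - 2 * lam) • fderiv ℝ f x = 0 := by
  have hfx := hf.contDiffAt (hg.isOpen.mem_nhds hx)
  have hdf : HasFDerivAt f _ x := (hfx.differentiableAt (by simp)).hasFDerivAt
  have hl := (hg.hasFDerivAt_fderiv_metricGradient hfx hx).const_mul (m * (m - 1))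
  have hr := (hdf.pow 2).neg.mul ((hdf.const_mul c).const_add ((m - 2) * lam))
  have heq := hl.unique (hr.congr_of_eventuallyEq (by
    filter_upwards [hg.isOpen.mem_nhds hx] with z hz
      using mul_fderiv_metricGradient_eq hm hE (hhess z hz) (hlap z hz)))
  ext u
  have heq_u := DFunLike.congr_fun heq u
  simp only [hhess x hx, ContinuousLinearMap.comp_smulₛₗ, Real.ringHom_apply,
    ContinuousLinearMap.comp_id, smul_apply, smul_eq_mul, Pi.neg_apply, neg_smul,
    Nat.add_one_sub_one, pow_one, nsmul_eq_mul, Nat.cast_ofNat, smul_neg, add_apply,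
    neg_apply] at heq_u
  field_simp at heq_u
  have hmul : f x * (((m + 2) * c * f x - 2 * lam) * fderiv ℝ f x u) = 0 := by
    linear_combination heq_u
  exact (mul_eq_zero.1 hmul).resolve_left (hf₀ x hx)

theorem eq_zero_of_hessianOp_eq (hg : IsCoordMetric g U) (hf : ContDiffOn ℝ ∞ f U)
    (hf₀ : ∀ x ∈ U, f x ≠ 0) (hm : m ≠ 0) (hE : Module.finrank ℝ E = 2)
    (hhess : ∀ x ∈ U,
      hessianOp g f x = (f x / m * (c * f x / 2 - lam)) • ContinuousLinearMap.id ℝ E)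
    (hlap : ∀ x ∈ U, f x * metricLaplacian g f x +
      (m - 1) * fderiv ℝ f x (metricGradient g f x) = -lam * f x ^ 2) (hU : U.Nonempty) :
    lam = 0 := by
  by_contra hlam
  obtain ⟨x, hx⟩ := hU
  have hconst (z : E) (hz : z ∈ U) : fderiv ℝ f z = 0 :=
    fderiv_eq_zero_of_mul_sub_smul_eq_zero hg.isOpen (hf.of_le (by simp))
      (mul_ne_zero two_ne_zero hlam)
      (fun z hz => hg.mul_sub_smul_fderiv_eq_zero hf hf₀ hm hE hhess hlap hz) hz
  have hgrad : metricGradient g f =ᶠ[nhds x] fun _ => 0 := by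
    filter_upwards [hg.isOpen.mem_nhds hx] with z hz
    rw [metricGradient, hconst z hz, map_zero]
  have hhess₀ : hessianOp g f x = 0 := by
    ext u
    simp [hessianOp_apply, hgrad.fderiv_eq, hgrad.eq_of_nhds]
  have hcf : c * f x / 2 - lam = 0 := by
    have : Nontrivial E := Module.nontrivial_of_finrank_pos (R := ℝ) (by omega)
    have hid : ContinuousLinearMap.id ℝ E ≠ 0 := one_ne_zero
    simpa [hhess₀, hf₀ x hx, hm, hid] using (hhess x hx).symm
  have hcf' : (m - 2) * lam + c * f x = 0 := by
    simpa [hconst x hx, hf₀ x hx] using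
      mul_fderiv_metricGradient_eq hm hE (hhess x hx) (hlap x hx)
  exact hlam ((mul_eq_zero.1 (show m * lam = 0 by linarith)).resolve_left hm)

variable {E' : Type*} [NormedAddCommGroup E'] [NormedSpace ℝ E'] [FiniteDimensional ℝ E']
  {h : E' → E' →L[ℝ] E' →L[ℝ] ℝ} {V : Set E'} {y : E'}

theorem hessianOp_eq_of_ricci_warpedForm_eq [Nontrivial E'] (hg : IsCoordMetric g U)
    (hh : IsCoordMetric h V) (hf : ContDiffOn ℝ ∞ f U) (hf₀ : ∀ x ∈ U, f x ≠ 0)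
    (hE : Module.finrank ℝ E = 2) (hx : x ∈ U) (hy : y ∈ V)
    (hRic : ∀ v w, ricci (warpedForm g f h) (x, y) v w = lam * warpedForm g f h (x, y) v w) :
    hessianOp g f x = (f x / Module.finrank ℝ E' * (scalarCurvature g x / 2 - lam)) •
      ContinuousLinearMap.id ℝ E := by
  have hm : (Module.finrank ℝ E' : ℝ) ≠ 0 := Nat.cast_ne_zero.2 Module.finrank_pos.ne'
  have hfx := hf₀ x hx
  refine ContinuousLinearMap.ext fun v => hg.ext hx fun w => ?_
  have hRic_vw := hRic (v, 0) (w, 0)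
  rw [ricci_warpedForm_base hg hh hf hf₀ hx hy, hg.ricci_eq_scalarCurvature_div_two_mul hx hE,
    warpedForm_apply] at hRic_vw
  simp only [map_zero, mul_zero, add_zero, smul_apply, ContinuousLinearMap.id_apply, map_smul,
    smul_eq_mul] at hRic_vw ⊢
  field_simp at hRic_vw ⊢
  linear_combination -hRic_vw

theorem metricLaplacian_eq_of_ricci_warpedForm_eq [Nontrivial E'] (hg : IsCoordMetric g U)
    (hh : IsCoordMetric h V) (hf : ContDiffOn ℝ ∞ f U) (hf₀ : ∀ x ∈ U, f x ≠ 0)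
    (hx : x ∈ U) (hy : y ∈ V) (hRic_h : ∀ a b, ricci h y a b = 0)
    (hRic : ∀ v w, ricci (warpedForm g f h) (x, y) v w = lam * warpedForm g f h (x, y) v w) :
    f x * metricLaplacian g f x +
      (Module.finrank ℝ E' - 1) * fderiv ℝ f x (metricGradient g f x) = -lam * f x ^ 2 := by
  obtain ⟨a, ha⟩ := exists_ne (0 : E')
  obtain ⟨b, hb⟩ : ∃ b, h y a b ≠ 0 := by
    by_contra! h₀
    exact ha (hh.nondegenerate y hy a h₀)
  have hRic_ab := hRic (0, a) (0, b)
  rw [ricci_warpedForm_fiber hg hh hf hf₀ hx hy, warpedForm_apply, hRic_h] at hRic_ab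
  simp only [zero_sub, map_zero, zero_add] at hRic_ab
  refine mul_left_cancel₀ hb ?_
  linear_combination -hRic_ab

theorem eq_zero_of_ricci_warpedForm_eq [Nontrivial E'] (hg : IsCoordMetric g U)
    (hh : IsCoordMetric h V) (hf : ContDiffOn ℝ ∞ f U) (hf₀ : ∀ x ∈ U, f x ≠ 0)
    (hE : Module.finrank ℝ E = 2) (hU : U.Nonempty) (hy : y ∈ V)
    (hR : ∀ x ∈ U, scalarCurvature g x = c * f x) (hRic_h : ∀ a b, ricci h y a b = 0)
    (hRic : ∀ x ∈ U, ∀ v w,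
      ricci (warpedForm g f h) (x, y) v w = lam * warpedForm g f h (x, y) v w) : lam = 0 :=
  hg.eq_zero_of_hessianOp_eq hf hf₀ (Nat.cast_ne_zero.2 Module.finrank_pos.ne') hE
    (fun x hx => hR x hx ▸
      hg.hessianOp_eq_of_ricci_warpedForm_eq hh hf hf₀ hE hx hy (hRic x hx))
    (fun x hx => hg.metricLaplacian_eq_of_ricci_warpedForm_eq hh hf hf₀ hx hy hRic_h (hRic x hx))
    hU

end IsCoordMetric

end EinsteinConstant

/-! ### Metrics in the charts of a manifold -/

section Charts

variable {E : Type*} [NormedAddCommGroup E] [NormedSpace ℝ E]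
  {H : Type*} [TopologicalSpace H] {I : ModelWithCorners ℝ E H}
  {B : Type*} [TopologicalSpace B]
  {E' : Type*} [NormedAddCommGroup E'] [NormedSpace ℝ E']
  {H' : Type*} [TopologicalSpace H'] {J : ModelWithCorners ℝ E' H'}
  {F : Type*} [TopologicalSpace F]
  {e : OpenPartialHomeomorph B H} {e' : OpenPartialHomeomorph F H'}

theorem extend_prod_target :
    ((e.prod e').extend (I.prod J)).target = (e.extend I).target ×ˢ (e'.extend J).target := by
  rw [OpenPartialHomeomorph.extend_prod, PartialEquiv.prod_target]

variable [ChartedSpace H B] [ChartedSpace H' F] [IsManifold I ∞ B] [IsManifold J ∞ F]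

theorem contMDiffOn_extend_symm_target (he : e ∈ atlas H B) :
    ContMDiffOn 𝓘(ℝ, E) I ∞ (e.extend I).symm (e.extend I).target := by
  rw [e.extend_target']
  exact contMDiffOn_extend_symm (IsManifold.subset_maximalAtlas he)

theorem contDiffOn_comp_extend_symm {f : B → ℝ} (hf : ContMDiff I 𝓘(ℝ, ℝ) ∞ f)
    (he : e ∈ atlas H B) : ContDiffOn ℝ ∞ (f ∘ (e.extend I).symm) (e.extend I).target :=
  contMDiffOn_iff_contDiffOn.1 (hf.comp_contMDiffOn (contMDiffOn_extend_symm_target he))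

variable [I.Boundaryless] [J.Boundaryless]

theorem mdifferentiableAt_extend_symm (he : e ∈ atlas H B) {y : E}
    (hy : y ∈ (e.extend I).target) : MDifferentiableAt 𝓘(ℝ, E) I (e.extend I).symm y :=
  ((contMDiffOn_extend_symm_target he).contMDiffAt
    ((e.isOpen_extend_target (I := I)).mem_nhds hy)).mdifferentiableAt (by simp)

theorem mfderiv_extend_symm_injective (he : e ∈ atlas H B) {y : E}
    (hy : y ∈ (e.extend I).target) :
    Function.Injective (mfderiv 𝓘(ℝ, E) I (e.extend I).symm y) := by
  have hp : (e.extend I).symm y ∈ e.source := by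
    simpa using (e.extend I).map_target hy
  have hextend : MDifferentiableAt I 𝓘(ℝ, E) (e.extend I) ((e.extend I).symm y) :=
    (e.contMDiffAt_extend (n := ∞) (IsManifold.subset_maximalAtlas he) hp).mdifferentiableAt
      (by simp)
  have hcomp := hextend.hasMFDerivAt.comp y (mdifferentiableAt_extend_symm he hy).hasMFDerivAt
  have hid : HasMFDerivAt 𝓘(ℝ, E) 𝓘(ℝ, E) (e.extend I ∘ (e.extend I).symm) y
      (ContinuousLinearMap.id ℝ (TangentSpace 𝓘(ℝ, E) y)) :=
    (hasMFDerivAt_id y).congr_of_eventuallyEq (by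
      filter_upwards [(e.isOpen_extend_target (I := I)).mem_nhds hy] with z hz
        using (e.extend I).right_inv hz)
  exact Function.LeftInverse.injective
    (g := mfderiv I 𝓘(ℝ, E) (e.extend I) ((e.extend I).symm y))
    (DFunLike.congr_fun (hasMFDerivAt_unique hcomp hid))

theorem IsSemiRiemannianMetric.isCoordMetric_chartForm [FiniteDimensional ℝ E]
    {g : FormField I B} (hg : IsSemiRiemannianMetric g) (he : e ∈ atlas H B) :
    IsCoordMetric (chartForm g e) (e.extend I).target where
  isOpen := e.isOpen_extend_target
  contDiffOn := hg.smooth e he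
  symm _ _ _ _ := hg.symm _ _ _
  nondegenerate y hy u hu := by
    let D : E →L[ℝ] TangentSpace I ((e.extend I).symm y) :=
      mfderiv 𝓘(ℝ, E) I (e.extend I).symm y ∘L
        (NormedSpace.fromTangentSpace (𝕜 := ℝ) y).symm.toContinuousLinearMap
    have hinj : Function.Injective D :=
      (mfderiv_extend_symm_injective he hy).comp
        (NormedSpace.fromTangentSpace (𝕜 := ℝ) y).symm.injective
    have hsurj : Function.Surjective D :=
      LinearMap.surjective_of_injective (K := ℝ) (V := E) (f := D.toLinearMap) hinj
    refine hinj ((hg.nondegenerate _ _ fun v => ?_).trans (map_zero D).symm)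
    obtain ⟨w, rfl⟩ := hsurj v
    exact hu w

theorem chartForm_warpedMetric (g : FormField I B) (f : B → ℝ) (h : FormField J F)
    (he : e ∈ atlas H B) (he' : e' ∈ atlas H' F) {q : E × E'}
    (hq : q ∈ ((e.prod e').extend (I.prod J)).target) :
    chartForm (warpedMetric g f h) (e.prod e') q =
      warpedForm (chartForm g e) (f ∘ (e.extend I).symm) (chartForm h e') q := by
  have hq' : q ∈ (e.extend I).target ×ˢ (e'.extend J).target := by
    rwa [extend_prod_target] at hq
  have hsymm := (mdifferentiableAt_extend_symm (I := I.prod J)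
    (Set.mem_image2_of_mem he he') hq).hasMFDerivAt
  have hfst := hasMFDerivAt_unique
    (HasMFDerivAt.comp q (mdifferentiableAt_fst (I := I) (I' := J)
      (x := ((e.prod e').extend (I.prod J)).symm q)).hasMFDerivAt hsymm)
    ((mdifferentiableAt_extend_symm (I := I) he hq'.1).hasMFDerivAt.comp q
      (hasFDerivAt_fst (𝕜 := ℝ) (p := q)).hasMFDerivAt)
  have hsnd := hasMFDerivAt_unique
    (HasMFDerivAt.comp q (mdifferentiableAt_snd (I := I) (I' := J)
      (x := ((e.prod e').extend (I.prod J)).symm q)).hasMFDerivAt hsymm)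
    ((mdifferentiableAt_extend_symm (I := J) he' hq'.2).hasMFDerivAt.comp q
      (hasFDerivAt_snd (𝕜 := ℝ) (p := q)).hasMFDerivAt)
  have hfst_apply (w : E × E') := DFunLike.congr_fun hfst w
  have hsnd_apply (w : E × E') := DFunLike.congr_fun hsnd w
  refine ContinuousLinearMap.ext fun u => ContinuousLinearMap.ext fun v => ?_
  exact congrArg₂ (· + ·)
    (congrArg₂ (fun a b => g ((e.extend I).symm q.1) a b) (hfst_apply u) (hfst_apply v))
    (congrArg (f ((e.extend I).symm q.1) ^ 2 * ·)
      (congrArg₂ (fun a b => h ((e'.extend J).symm q.2) a b) (hsnd_apply u) (hsnd_apply v)))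

variable [FiniteDimensional ℝ E] [FiniteDimensional ℝ E']

theorem ricci_chartForm_warpedMetric (g : FormField I B) (f : B → ℝ) (h : FormField J F)
    (he : e ∈ atlas H B) (he' : e' ∈ atlas H' F) {q : E × E'}
    (hq : q ∈ ((e.prod e').extend (I.prod J)).target) :
    ricci (chartForm (warpedMetric g f h) (e.prod e')) q =
      ricci (warpedForm (chartForm g e) (f ∘ (e.extend I).symm) (chartForm h e')) q := by
  have hopen : IsOpen ((e.prod e').extend (I.prod J)).target := by
    rw [extend_prod_target]
    exact e.isOpen_extend_target.prod e'.isOpen_extend_target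
  refine ricci_congr ?_
  filter_upwards [hopen.mem_nhds hq] with z hz using chartForm_warpedMetric g f h he he' hz

namespace IsEinsteinWarpedProduct

variable {g : FormField I B} {f : B → ℝ} {h : FormField J F} {lam : ℝ}

theorem ricci_warpedForm_eq (hw : IsEinsteinWarpedProduct g f h lam) (he : e ∈ atlas H B)
    (he' : e' ∈ atlas H' F) {x : E} {y : E'} (hx : x ∈ (e.extend I).target)
    (hy : y ∈ (e'.extend J).target) (v w : E × E') :
    ricci (warpedForm (chartForm g e) (f ∘ (e.extend I).symm) (chartForm h e')) (x, y) v w =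
      lam * warpedForm (chartForm g e) (f ∘ (e.extend I).symm) (chartForm h e') (x, y) v w := by
  have hq : (x, y) ∈ ((e.prod e').extend (I.prod J)).target := by
    rw [extend_prod_target]
    exact Set.mk_mem_prod hx hy
  rw [← ricci_chartForm_warpedMetric g f h he he' hq, ← chartForm_warpedMetric g f h he he' hq]
  exact hw.einstein _ (Set.mem_image2_of_mem he he') _ hq v w

theorem eq_zero_of_isFCurvatureBase [Nonempty B] [Nonempty F] [Nontrivial E']
    (hw : IsEinsteinWarpedProduct g f h lam) (hE : Module.finrank ℝ E = 2)
    (hbase : IsFCurvatureBase g f) (hfiber : IsEinstein h 0) : lam = 0 := by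
  obtain ⟨c, hc⟩ := hbase
  obtain ⟨b⟩ := ‹Nonempty B›
  obtain ⟨p⟩ := ‹Nonempty F›
  have he := chart_mem_atlas H b
  have he' := chart_mem_atlas H' p
  have hp := mem_extChartAt_target (I := J) p
  exact (hw.base_metric.isCoordMetric_chartForm he).eq_zero_of_ricci_warpedForm_eq
    (hw.fiber_metric.isCoordMetric_chartForm he') (contDiffOn_comp_extend_symm hw.smooth he)
    (fun x _ => (hw.pos _).ne') hE ⟨_, mem_extChartAt_target b⟩ hp (hc _ he)
    (fun u v => (hfiber _ he' _ hp u v).trans (zero_mul _))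
    fun x hx => hw.ricci_warpedForm_eq he he' hx hp

end IsEinsteinWarpedProduct

end Charts

/-! ### Flat space -/

section Flat

variable {E : Type*} [NormedAddCommGroup E] [InnerProductSpace ℝ E]

/-- The flat metric of a Euclidean space. -/
def flatMetric (E : Type*) [NormedAddCommGroup E] [InnerProductSpace ℝ E] : FormField 𝓘(ℝ, E) E :=
  fun _ => (innerSL ℝ : E →L[ℝ] E →L[ℝ] ℝ)

theorem chartForm_flatMetric {e : OpenPartialHomeomorph E E} (he : e ∈ atlas E E) :
    chartForm (flatMetric E) e = fun _ => (innerSL ℝ : E →L[ℝ] E →L[ℝ] ℝ) := by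
  obtain rfl : e = OpenPartialHomeomorph.refl E := by simpa using he
  have hid : (((OpenPartialHomeomorph.refl E).extend 𝓘(ℝ, E)).symm : E → E) = id := by
    ext
    simp
  have hd (y : E) : mfderiv 𝓘(ℝ, E) 𝓘(ℝ, E)
      ((OpenPartialHomeomorph.refl E).extend 𝓘(ℝ, E)).symm y = ContinuousLinearMap.id ℝ E := by
    rw [hid]
    exact mfderiv_id
  funext y
  have hd_apply (w : E) := DFunLike.congr_fun (hd y) w
  refine ContinuousLinearMap.ext fun u => ContinuousLinearMap.ext fun v => ?_
  exact congrArg₂ (fun a b : E => inner ℝ a b) (hd_apply u) (hd_apply v)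

theorem isRiemannianMetric_flatMetric : IsRiemannianMetric (flatMetric E) where
  symm _ u v := real_inner_comm (F := E) v u
  nondegenerate _ u hu := inner_self_eq_zero (𝕜 := ℝ) (E := E).1 (hu u)
  smooth e he := by
    rw [chartForm_flatMetric he]
    exact contDiffOn_const
  pos _ _ hu := real_inner_self_pos (F := E).2 hu

variable [FiniteDimensional ℝ E]

theorem isEinstein_flatMetric : IsEinstein (flatMetric E) 0 := by
  intro e he y _ u v
  rw [chartForm_flatMetric he, ricci_const]
  simp

theorem hasScalarCurvature_flatMetric : HasScalarCurvature (flatMetric E) fun _ => 0 := by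
  intro e he y _
  rw [chartForm_flatMetric he, scalarCurvature, ricci_const]
  simp

theorem isFCurvatureBase_flatMetric (f : E → ℝ) : IsFCurvatureBase (flatMetric E) f :=
  ⟨0, by simpa using hasScalarCurvature_flatMetric (E := E)⟩

theorem isEinsteinWarpedProduct_flatMetric {E' : Type*} [NormedAddCommGroup E']
    [InnerProductSpace ℝ E'] [FiniteDimensional ℝ E'] :
    IsEinsteinWarpedProduct (flatMetric E) (fun _ => 1) (flatMetric E') 0 where
  base_metric := isRiemannianMetric_flatMetric.toIsSemiRiemannianMetric
  fiber_metric := isRiemannianMetric_flatMetric.toIsSemiRiemannianMetric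
  smooth := contMDiff_const
  pos _ := one_pos
  einstein := by
    rintro _ ⟨e, he, e', he', rfl⟩ q hq u v
    have hconst : warpedForm (chartForm (flatMetric E) e) ((fun _ => 1) ∘ (e.extend 𝓘(ℝ, E)).symm)
        (chartForm (flatMetric E') e') = fun _ => warpedForm
          (fun _ : E => (innerSL ℝ : E →L[ℝ] E →L[ℝ] ℝ)) (fun _ => 1)
          (fun _ : E' => (innerSL ℝ : E' →L[ℝ] E' →L[ℝ] ℝ)) 0 := by
      rw [chartForm_flatMetric he, chartForm_flatMetric he']
      rfl
    rw [ricci_chartForm_warpedMetric _ _ _ he he' hq, hconst, ricci_const]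
    simp

end Flat

end

theorem theorem3_general (m : ℕ) [NeZero m] :
    (∀ (B : Type u) [TopologicalSpace B] [ChartedSpace (EuclideanSpace ℝ (Fin 2)) B]
      [IsManifold (𝓡 2) ∞ B] [Nonempty B]
      (F : Type v) [TopologicalSpace F] [ChartedSpace (EuclideanSpace ℝ (Fin m)) F]
      [IsManifold (𝓡 m) ∞ F] [Nonempty F]
      (g : FormField (𝓡 2) B) (f : B → ℝ) (h : FormField (𝓡 m) F) (lam : ℝ),
      IsEinsteinWarpedProduct g f h lam → IsFCurvatureBase g f → IsEinstein h 0 → lam = 0) ∧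
    (∃ (B : Type) (_ : TopologicalSpace B) (_ : ChartedSpace (EuclideanSpace ℝ (Fin 2)) B)
      (_ : IsManifold (𝓡 2) ∞ B) (_ : T2Space B) (_ : SecondCountableTopology B)
      (_ : ConnectedSpace B)
      (F : Type) (_ : TopologicalSpace F) (_ : ChartedSpace (EuclideanSpace ℝ (Fin m)) F)
      (_ : IsManifold (𝓡 m) ∞ F) (_ : T2Space F) (_ : SecondCountableTopology F)
      (_ : ConnectedSpace F)
      (g : FormField (𝓡 2) B) (f : B → ℝ) (h : FormField (𝓡 m) F),
      IsRiemannianMetric g ∧ IsRiemannianMetric h ∧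
      IsEinsteinWarpedProduct g f h 0 ∧ IsFCurvatureBase g f ∧ IsEinstein h 0) := by
  refine ⟨fun B _ _ _ _ F _ _ _ _ g f h lam hw hbase hfiber => ?_, ?_⟩
  · exact hw.eq_zero_of_isFCurvatureBase finrank_euclideanSpace_fin hbase hfiber
  · exact ⟨EuclideanSpace ℝ (Fin 2), inferInstance, inferInstance, inferInstance, inferInstance,
      inferInstance, inferInstance, EuclideanSpace ℝ (Fin m), inferInstance, inferInstance,
      inferInstance, inferInstance, inferInstance, inferInstance, flatMetric _, fun _ => 1,
      flatMetric _, isRiemannianMetric_flatMetric, isRiemannianMetric_flatMetric,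
      isEinsteinWarpedProduct_flatMetric, isFCurvatureBase_flatMetric _, isEinstein_flatMetric⟩

theorem theorem3 :
    -- An Einstein warped product over such a base with Ricci-flat fibre has `lam = 0`.
    (∀ (B : Type u) [TopologicalSpace B] [ChartedSpace (EuclideanSpace ℝ (Fin 2)) B]
      [IsManifold (𝓡 2) ∞ B] [Nonempty B]
      (F : Type v) [TopologicalSpace F] [ChartedSpace (EuclideanSpace ℝ (Fin 2)) F]
      [IsManifold (𝓡 2) ∞ F] [Nonempty F]
      (g : FormField (𝓡 2) B) (f : B → ℝ) (h : FormField (𝓡 2) F) (lam : ℝ),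
      IsEinsteinWarpedProduct g f h lam → IsFCurvatureBase g f → IsEinstein h 0 → lam = 0) ∧
    -- For `lam = 0` such warped products do exist, even Riemannian ones.
    (∃ (B : Type) (_ : TopologicalSpace B) (_ : ChartedSpace (EuclideanSpace ℝ (Fin 2)) B)
      (_ : IsManifold (𝓡 2) ∞ B) (_ : T2Space B) (_ : SecondCountableTopology B)
      (_ : ConnectedSpace B)
      (F : Type) (_ : TopologicalSpace F) (_ : ChartedSpace (EuclideanSpace ℝ (Fin 2)) F)
      (_ : IsManifold (𝓡 2) ∞ F) (_ : T2Space F) (_ : SecondCountableTopology F)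
      (_ : ConnectedSpace F)
      (g : FormField (𝓡 2) B) (f : B → ℝ) (h : FormField (𝓡 2) F),
      IsRiemannianMetric g ∧ IsRiemannianMetric h ∧
      IsEinsteinWarpedProduct g f h 0 ∧ IsFCurvatureBase g f ∧ IsEinstein h 0) :=
  theorem3_general 2
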